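/- For a positive integer $x$ let $\sigma(x)=\sum_{d\mid x} d$, and put $\sigma(x)=0$ for every rational number $x$ that is not a positive integer. For positive integers $a,b,n$ let $$W_{a,b}(n)=\sum_{\substack{l,m\ge 1\\ al+bm=n}}\sigma(l)\,\sigma(m).$$ Let $M_4(N)$ be the finite-dimensional complex vector space of modular forms of weight $4$ on $\Gamma_0(N)$ (trivial character), and let $\lambda_4(N)$ be its dimension. Let $a,b$ be relatively prime positive integers, let $g_1,\dots,g_{\lambda_4(ab)}$ be any basis of $M_4(ab)$, and let $b_i(n)$ denote the $n$-th Fourier coefficient of $g_i$, so that $g_i(z)=\sum_{n\ge 0} b_i(n)e^{2\pi i n z}$. Then there exist constants $\beta_i\in\mathbb{C}$, $1\le i\le\lambda_4(ab)$, not depending on $n$, such that for every positive integer $n$ $$W_{a,b}(n)=\frac1{24}\Bigl(1-\frac{6n}{b}\Bigr)\sigma\Bigl(\frac na\Bigr)+\frac1{24}\Bigl(1-\frac{6n}{a}\Bigr)\sigma\Bigl(\frac nb\Bigr)-\frac1{576}\sum_{i=1}^{\lambda_4(ab)}\beta_i\,b_i(n).$$ -/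

import Mathlib

open scoped MatrixGroups

/-- The divisor function `σ_r(x) = ∑_{d ∣ x} d ^ r` for a positive integer `x`, extended by `0` to
all rational numbers that are not positive integers. -/
def sigmaExt (r : ℕ) (x : ℚ) : ℕ :=
  if 0 < x ∧ x.den = 1 then ArithmeticFunction.sigma r x.num.toNat else 0

/-- The pairs `(l, m)` of positive integers with `a * l + b * m = n`
(for positive `a`, `b`; see `mem_convPairs`). -/
def convPairs (a b n : ℕ) : Finset (ℕ × ℕ) :=
  (Finset.Icc 1 n ×ˢ Finset.Icc 1 n).filter fun p => a * p.1 + b * p.2 = n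

theorem mem_convPairs {a b : ℕ} (ha : 0 < a) (hb : 0 < b) (n : ℕ) (p : ℕ × ℕ) :
    p ∈ convPairs a b n ↔ 0 < p.1 ∧ 0 < p.2 ∧ a * p.1 + b * p.2 = n := by
  simp only [convPairs, Finset.mem_filter, Finset.mem_product, Finset.mem_Icc]
  constructor
  · rintro ⟨⟨⟨h1, _⟩, h2, _⟩, h⟩
    exact ⟨h1, h2, h⟩
  · rintro ⟨h1, h2, h⟩
    have := Nat.le_mul_of_pos_left p.1 ha
    have := Nat.le_mul_of_pos_left p.2 hb
    exact ⟨⟨⟨h1, by omega⟩, h2, by omega⟩, h⟩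

/-- The convolution sum `W_{a,b}^{r,s}(n) = ∑_{l, m ≥ 1, a l + b m = n} σ_r(l) σ_s(m)`. -/
def convSum (r s a b n : ℕ) : ℕ :=
  ∑ p ∈ convPairs a b n, ArithmeticFunction.sigma r p.1 * ArithmeticFunction.sigma s p.2

/-- The space `M_k(N)` of modular forms of weight `k` on `Γ₀(N)` (trivial character). -/
abbrev ModFormSpace (k : ℤ) (N : ℕ) : Type :=
  ModularForm ((CongruenceSubgroup.Gamma0 N).map (Matrix.SpecialLinearGroup.mapGL ℝ)) k

/-- The dimension `λ_k(N)` of `M_k(N)`. -/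
noncomputable def modFormDim (k : ℤ) (N : ℕ) : ℕ :=
  Module.finrank ℂ (ModFormSpace k N)

/-- The `n`-th Fourier coefficient of `f` at infinity, in powers of `q = exp (2 π i z)`. -/
noncomputable def fourierCoeffInf {k : ℤ} {N : ℕ} (f : ModFormSpace k N) (n : ℕ) : ℂ :=
  (UpperHalfPlane.qExpansion 1 f).coeff n

open Function UpperHalfPlane Derivative EisensteinSeries
open scoped ModularForm Manifold Topology

/-! Since `E2` is 1 - 24 ∑ σ(m) q^m, the sum W_{a,b}(n) is 1/576 of the n-th coefficient of
E₂(az)E₂(bz), up to σ(n/a) and σ(n/b). Squaring aE₂(az) - bE₂(bz) produces this product as its cross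
term. The difference is modular of weight 2 on Γ₀(ab), because the nonholomorphic corrections of its
two terms cancel (`E2_slash_sub_eq`). By Ramanujan's identity, E₂² - 12 DE₂ is modular of weight 4
(`ramanujanE4_slash`), so both squares can be subtracted at the cost of derivatives DE₂, whose
coefficients are -24 m σ(m). What remains is a form Φ in M₄(ab) (`coe_convolutionForm`); its
coordinates in the basis, rescaled, are the β_i. -/

/-- A holomorphic function on the upper half plane which is the sum of the power series
`∑ c m * q ^ m` in `q = exp (2 π i z)`. -/
structure HasQSeries (f : ℍ → ℂ) (c : ℕ → ℂ) : Prop where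
  mdiff : MDiff f
  hasSum : ∀ τ : ℍ, HasSum (fun m ↦ c m • Periodic.qParam 1 τ ^ m) (f τ)

/-! ### Calculus of q-series -/

namespace HasQSeries

variable {f g : ℍ → ℂ} {c d : ℕ → ℂ}

theorem bounded (hf : HasQSeries f c) : IsBoundedAtImInfty f :=
  isBoundedAtImInfty_of_hasSum_qExpansion one_pos hf.hasSum

theorem periodic (hf : HasQSeries f c) : Periodic (f ∘ ofComplex) ((1 : ℝ) : ℂ) := by
  intro w
  by_cases! hw : 0 < w.im
  · have h1 : 0 < (w + ((1 : ℝ) : ℂ)).im := by simpa using hw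
    simp only [comp_apply, ofComplex_apply_of_im_pos h1, ofComplex_apply_of_im_pos hw]
    refine (hf.hasSum _).unique ?_
    have h2 : Periodic.qParam 1 (w + ((1 : ℝ) : ℂ)) = Periodic.qParam 1 w :=
      by simp [Periodic.qParam, mul_add, Complex.exp_add]
    simpa only [h2] using hf.hasSum ⟨w, hw⟩
  · have : (w + ((1 : ℝ) : ℂ)).im ≤ 0 := by simpa using hw
    simp only [comp_apply, ofComplex_apply_of_im_nonpos this, ofComplex_apply_of_im_nonpos hw]

theorem analyticAt (hf : HasQSeries f c) : AnalyticAt ℂ (cuspFunction 1 f) 0 :=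
  analyticAt_cuspFunction_zero one_pos hf.periodic hf.mdiff hf.bounded

theorem coeff_eq (hf : HasQSeries f c) (m : ℕ) : (qExpansion 1 f).coeff m = c m :=
  (@qExpansion_coeff_unique (ℍ → ℂ) ⟨id, injective_id⟩ 1 f c one_pos hf.analyticAt hf.hasSum m).symm

theorem add (hf : HasQSeries f c) (hg : HasQSeries g d) : HasQSeries (f + g) (c + d) where
  mdiff := hf.mdiff.add hg.mdiff
  hasSum τ := by simpa [add_mul] using (hf.hasSum τ).add (hg.hasSum τ)

theorem smul (hf : HasQSeries f c) (a : ℂ) : HasQSeries (a • f) (a • c) where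
  mdiff := hf.mdiff.const_smul a
  hasSum τ := by simpa [mul_assoc] using (hf.hasSum τ).mul_left a

theorem mul (hf : HasQSeries f c) (hg : HasQSeries g d) :
    HasQSeries (f * g) (fun n ↦ ∑ p ∈ Finset.HasAntidiagonal.antidiagonal n, c p.1 * d p.2) where
  mdiff := hf.mdiff.mul hg.mdiff
  hasSum τ := by
    have hper : Periodic ((f * g) ∘ ofComplex) ((1 : ℝ) : ℂ) := hf.periodic.mul hg.periodic
    have := hasSum_qExpansion one_pos hper (hf.mdiff.mul hg.mdiff) (hf.bounded.mul hg.bounded) τ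
    simpa [qExpansion_mul hf.analyticAt hg.analyticAt, PowerSeries.coeff_mul, hf.coeff_eq,
      hg.coeff_eq] using this

theorem normalizedDeriv (hf : HasQSeries f c) : HasQSeries (D f) (fun n ↦ n * c n) where
  mdiff := normalizedDerivOfComplex_mdifferentiable hf.mdiff
  hasSum τ := by
    set q := Periodic.qParam 1 τ with hq
    have hq1 : ‖q‖ < 1 := Periodic.norm_qParam_lt_one one_pos τ.im_pos
    have hdiff := differentiableOn_cuspFunction_ball one_pos hf.periodic hf.mdiff hf.bounded
    have hqd : HasDerivAt (Periodic.qParam 1) (q * (2 * Real.pi * Complex.I)) (τ : ℂ) := by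
      have h0 : Periodic.qParam 1 = fun w ↦ Complex.exp (2 * Real.pi * Complex.I * id w) := by
        ext w
        simp [Periodic.qParam]
      have h := ((hasDerivAt_id (τ : ℂ)).const_mul (2 * Real.pi * Complex.I)).cexp
      rw [hq, h0]
      simpa only [mul_one] using! h
    have hF : HasDerivAt (cuspFunction 1 f) (deriv (cuspFunction 1 f) q) q :=
      (differentiableAt_cuspFunction one_pos hf.periodic hf.mdiff hf.bounded hq1).hasDerivAt
    have hcomp : f ∘ ofComplex =ᶠ[𝓝 (τ : ℂ)] cuspFunction 1 f ∘ Periodic.qParam 1 := by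
      filter_upwards [isOpen_upperHalfPlaneSet.mem_nhds τ.im_pos] with w hw
      have := eq_cuspFunction (f := f) ⟨w, hw⟩ one_ne_zero hf.periodic
      simp only [comp_apply, ofComplex_apply_of_im_pos hw]
      exact this.symm
    -- With f = F(q), D becomes q d/dq; the Taylor series of F' at 0 then gives the coefficients,
    -- shifted by one.
    have hD : D f τ = q * deriv (cuspFunction 1 f) q := by
      rw [normalizedDerivOfComplex, ((hF.comp (τ : ℂ) hqd).congr_of_eventuallyEq hcomp).deriv]
      have := Complex.two_pi_I_ne_zero
      field_simp
    have hT := (Complex.hasSum_taylorSeries_on_ball (c := 0) (r := 1) (z := q)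
      (hdiff.deriv Metric.isOpen_ball) (by simpa using hq1)).mul_left q
    rw [hD, ← hasSum_nat_add_iff' 1]
    simp only [Finset.range_one, Finset.sum_singleton, Nat.cast_zero, zero_mul, zero_smul, sub_zero]
    have hterm (n : ℕ) : ((((n + 1 : ℕ) : ℂ) * c (n + 1)) • q ^ (n + 1)) =
        q * ((n.factorial : ℂ)⁻¹ • (q - 0) ^ n • iteratedDeriv n (deriv (cuspFunction 1 f)) 0) := by
      rw [← hf.coeff_eq, qExpansion_coeff, iteratedDeriv_succ', Nat.factorial_succ]
      have h1 : ((n : ℂ) + 1) ≠ 0 := n.cast_add_one_ne_zero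
      have h2 : (n.factorial : ℂ) ≠ 0 := Nat.cast_ne_zero.mpr n.factorial_ne_zero
      push_cast
      simp only [smul_eq_mul, sub_zero]
      field_simp
      ring
    simp only [hterm]
    exact hT

end HasQSeries

theorem hasQSeries_E2 : HasQSeries EisensteinSeries.E2
    (fun m ↦ if m = 0 then 1 else -24 * (ArithmeticFunction.sigma 1 m : ℂ)) where
  mdiff := E2_mdifferentiable
  hasSum τ := by
    simpa only [Periodic.qParam, Complex.ofReal_one, div_one] using
      EisensteinSeries.hasSum_qExpansion_E2 (z := τ)

/-! ### Rescaling z ↦ az as a slash action -/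

/-- The matrix `diag(a, 1)`. -/
noncomputable def diagGL (a : ℕ) (ha : 0 < a) : GL (Fin 2) ℝ :=
  Matrix.GeneralLinearGroup.mkOfDetNeZero !![(a : ℝ), 0; 0, 1] (by simpa using ha.ne')

theorem coe_diagGL_smul (a : ℕ) (ha : 0 < a) (τ : ℍ) :
    ((diagGL a ha • τ : ℍ) : ℂ) = a * τ := by
  rw [UpperHalfPlane.coe_smul_of_det_pos]
  · simp [num, denom, diagGL, Matrix.GeneralLinearGroup.mkOfDetNeZero]
  · simpa [diagGL, Matrix.GeneralLinearGroup.mkOfDetNeZero] using ha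

theorem slash_diagGL_apply (k : ℤ) (f : ℍ → ℂ) (a : ℕ) (ha : 0 < a) (τ : ℍ) :
    (f ∣[k] diagGL a ha) τ = (a : ℂ) ^ (k - 1) * f (diagGL a ha • τ) := by
  have hdet : (diagGL a ha).det.val = a := by
    simp [diagGL, Matrix.GeneralLinearGroup.mkOfDetNeZero]
  have hd : denom (diagGL a ha) τ = 1 := by
    simp [denom, diagGL, Matrix.GeneralLinearGroup.mkOfDetNeZero]
  have hs (x : ℂ) : σ (diagGL a ha) x = x := by
    have : 0 < (diagGL a ha).det.val := by rw [hdet]; exact_mod_cast ha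
    simp only [σ, this, if_true]
    rfl
  rw [ModularForm.slash_apply, hs, hdet, hd]
  simp [mul_comm]

theorem HasQSeries.slash_diagGL {f : ℍ → ℂ} {c : ℕ → ℂ} (hf : HasQSeries f c) (k : ℤ) (a : ℕ)
    (ha : 0 < a) : HasQSeries (f ∣[k] diagGL a ha)
      (fun n ↦ (a : ℂ) ^ (k - 1) * if a ∣ n then c (n / a) else 0) where
  mdiff := hf.mdiff.slash k _
  hasSum τ := by
    rw [slash_diagGL_apply]
    simp only [smul_eq_mul, mul_assoc]
    refine HasSum.mul_left _ ?_
    have hinj : Injective (fun m : ℕ ↦ a * m) := fun x y h ↦ Nat.eq_of_mul_eq_mul_left ha h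
    refine (hinj.hasSum_iff ?_).mp ?_
    · intro n hn
      rw [if_neg, zero_mul]
      rintro ⟨m, rfl⟩
      exact hn ⟨m, rfl⟩
    · have hq : Periodic.qParam 1 (diagGL a ha • τ : ℍ) = Periodic.qParam 1 τ ^ a := by
        rw [coe_diagGL_smul, Periodic.qParam, Periodic.qParam, ← Complex.exp_nat_mul]
        congr 1
        ring
      have := hf.hasSum (diagGL a ha • τ)
      simpa [comp_def, hq, ← pow_mul, ha] using this

/-! ### Quasimodularity of E₂ and Ramanujan's form in level one -/

/-- The nonholomorphic Eisenstein series `E₂(z) - 3 / (π Im z)` of weight `2`. -/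
noncomputable def E2Star (z : ℍ) : ℂ := E2 z - 3 / (Real.pi * z.im)

theorem E2_slash_apply (γ : SL(2, ℤ)) (z : ℍ) :
    (E2 ∣[(2 : ℤ)] γ) z = E2 z - 6 * Complex.I / Real.pi * (γ 1 0 / denom γ z) := by
  rw [E2_slash_action]
  have := Complex.ofReal_ne_zero.mpr Real.pi_ne_zero
  have h2 := denom_ne_zero γ z
  simp only [Pi.sub_apply, Pi.smul_apply, D2, riemannZeta_two, smul_eq_mul]
  field_simp

theorem E2Star_slash (γ : SL(2, ℤ)) : E2Star ∣[(2 : ℤ)] γ = E2Star := by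
  ext z
  have hE := E2_slash_apply γ z
  rw [ModularForm.SL_slash_apply] at hE ⊢
  have h2 := denom_ne_zero γ z
  have hpi := Complex.ofReal_ne_zero.mpr Real.pi_ne_zero
  have hy : (z.im : ℂ) ≠ 0 := Complex.ofReal_ne_zero.mpr z.im_ne_zero
  have him : ((γ • z).im : ℂ) = z.im / (denom γ z * (starRingEnd ℂ) (denom γ z)) := by
    rw [ModularGroup.im_smul_eq_div_normSq, Complex.mul_conj]
    push_cast
    rfl
  -- This turns 1 / Im(γz) into |cz + d|² / Im z, with a defect linear in c that cancels that of
  -- `E2`.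
  have hc : (starRingEnd ℂ) (denom γ z) = denom γ z - 2 * Complex.I * γ 1 0 * z.im := by
    rw [ModularGroup.denom_apply]
    apply Complex.ext
    · simp
    · simp
      ring
  rw [E2Star, E2Star, sub_mul, hE, him]
  have hc0 : (starRingEnd ℂ) (denom γ z) ≠ 0 := by simpa only [ne_eq, map_eq_zero]
  have : denom γ z ^ (-2 : ℤ) = (denom γ z ^ 2)⁻¹ := by
    rw [zpow_neg]; rfl
  rw [this]
  field_simp
  rw [hc]
  ring

theorem isBoundedAtImInfty_E2Star : IsBoundedAtImInfty E2Star := by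
  refine isBoundedAtImInfty_E2.sub ?_
  refine isBoundedAtImInfty_iff.mpr ⟨1, 1, fun z hz ↦ ?_⟩
  have h3 := Real.pi_gt_three
  rw [norm_div, norm_mul, Complex.norm_real, Complex.norm_real, Real.norm_of_nonneg Real.pi_pos.le,
    Real.norm_of_nonneg z.im_pos.le, div_le_one (by positivity)]
  simp only [RCLike.norm_ofNat]
  nlinarith

/-- The function `E₂² - 12 D E₂`, a modular form of weight `4` and level one. -/
noncomputable def ramanujanE4 : ℍ → ℂ := E2 * E2 - (12 : ℂ) • D E2

/-- With u = c/(cz + d), the defects of E₂² and of 12 DE₂ are both -(12i/π) u E₂ - (36/π²) u². -/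
theorem ramanujanE4_slash (γ : SL(2, ℤ)) : ramanujanE4 ∣[(4 : ℤ)] γ = ramanujanE4 := by
  have hpi := Complex.ofReal_ne_zero.mpr Real.pi_ne_zero
  have hmul : (E2 * E2) ∣[(4 : ℤ)] γ = (E2 ∣[(2 : ℤ)] γ) * (E2 ∣[(2 : ℤ)] γ) :=
    ModularForm.mul_slash_SL2 2 2 γ E2 E2
  have hD := normalizedDerivOfComplex_SL_slash (k := 2) E2_mdifferentiable (γ := γ)
  ext z
  have hD' := congrFun hD z
  have hd := denom_ne_zero γ z
  -- The extra term is D applied to -(6i/π) u, using u' = -u².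
  have hder : D (E2 ∣[(2 : ℤ)] γ) z =
      D E2 z + 3 / Real.pi ^ 2 * (γ 1 0 / denom γ z) ^ 2 := by
    have h1 : HasDerivAt (fun w : ℂ ↦ ((γ 1 0 : ℤ) : ℂ) * (denom γ w)⁻¹)
        (((γ 1 0 : ℤ) : ℂ) * (-((γ 1 0 : ℤ) : ℂ) / denom γ z ^ 2)) (z : ℂ) := by
      have h0 : HasDerivAt (fun w : ℂ ↦ denom γ w) ((γ 1 0 : ℤ) : ℂ) (z : ℂ) := by
        simpa [denom] using (((hasDerivAt_id (z : ℂ)).const_mul ((γ 1 0 : ℤ) : ℂ)).add_const ((γ 1 1 : ℤ) : ℂ))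
      exact (h0.fun_inv hd).const_mul _
    have h2 := (mdifferentiableAt_iff.mp (E2_mdifferentiable z)).hasDerivAt
    have h3 := h2.sub (h1.const_mul (6 * Complex.I / Real.pi))
    have heq : (E2 ∣[(2 : ℤ)] γ) ∘ ofComplex =ᶠ[𝓝 (z : ℂ)] (E2 ∘ ofComplex) -
        fun w : ℂ ↦ 6 * Complex.I / Real.pi * (((γ 1 0 : ℤ) : ℂ) * (denom γ w)⁻¹) := by
      filter_upwards [isOpen_upperHalfPlaneSet.mem_nhds z.im_pos] with w hw
      simp [E2_slash_apply, ofComplex_apply_of_im_pos hw, div_eq_mul_inv]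
    rw [normalizedDerivOfComplex, (h3.congr_of_eventuallyEq heq).deriv, normalizedDerivOfComplex]
    field_simp
    ring
  have hDγ : (D E2 ∣[(4 : ℤ)] γ) z = D (E2 ∣[(2 : ℤ)] γ) z +
      2 * (2 * Real.pi * Complex.I)⁻¹ * (γ 1 0 / denom γ z) * (E2 ∣[(2 : ℤ)] γ) z := by
    rw [hD']
    simp
  have hsub : ramanujanE4 ∣[(4 : ℤ)] γ =
      (E2 * E2) ∣[(4 : ℤ)] γ - (12 : ℂ) • (D E2 ∣[(4 : ℤ)] γ) := by
    rw [ramanujanE4, sub_eq_add_neg, SlashAction.add_slash, SlashAction.neg_slash,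
      ModularForm.SL_smul_slash, ← sub_eq_add_neg]
  rw [hsub, hmul]
  simp only [Pi.sub_apply, Pi.mul_apply, Pi.smul_apply, smul_eq_mul, hDγ, hder, ramanujanE4]
  rw [E2_slash_apply]
  generalize (γ 1 0 : ℂ) / denom γ z = u
  field_simp
  linear_combination (36 * Complex.I * u ^ 2 - 12 * E2 z * Real.pi * u) * Complex.I_sq

/-! ### From level one to Γ₀(N) by conjugation -/

section conjugation

open ConjAct Pointwise

variable {Γ : Subgroup (GL (Fin 2) ℝ)} {A : GL (Fin 2) ℝ} {k : ℤ} {F : ℍ → ℂ}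

theorem slash_slash_of_conj_mem_SL (hA : ∀ γ ∈ Γ, A * γ * A⁻¹ ∈ 𝒮ℒ)
    (hF : ∀ γ : SL(2, ℤ), F ∣[k] γ = F) {γ : GL (Fin 2) ℝ} (hγ : γ ∈ Γ) :
    (F ∣[k] A) ∣[k] γ = F ∣[k] A := by
  obtain ⟨δ, hδ⟩ := hA γ hγ
  rw [← SlashAction.slash_mul, show A * γ = Matrix.SpecialLinearGroup.mapGL ℝ δ * A by
    rw [hδ]; group, SlashAction.slash_mul]
  congr 1
  exact hF δ

/-- `A` carries cusps of Γ to cusps of SL₂(ℤ), where invariance of `F` reduces boundedness to i∞. -/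
theorem isBoundedAt_slash_of_conj_mem_SL (hA : ∀ γ ∈ Γ, A * γ * A⁻¹ ∈ 𝒮ℒ)
    (hF : ∀ γ : SL(2, ℤ), F ∣[k] γ = F) (hb : IsBoundedAtImInfty F) {c : OnePoint ℝ}
    (hc : IsCusp c Γ) : c.IsBoundedAt (F ∣[k] A) k := by
  rw [← OnePoint.IsBoundedAt.smul_iff]
  have hc' : IsCusp (A • c) 𝒮ℒ := by
    refine (hc.smul A).mono ?_
    rintro _ ⟨γ, hγ, rfl⟩
    exact hA γ hγ
  rw [OnePoint.isBoundedAt_iff_forall_SL2Z hc']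
  intro γ _
  rwa [hF γ]

end conjugation

/-- Conjugation multiplies the upper right entry by a and divides the lower left one by a, which N,
hence a, divides. -/
theorem diagGL_conj_mem_SL {a N : ℕ} (ha : 0 < a) (haN : a ∣ N) {γ : GL (Fin 2) ℝ}
    (hγ : γ ∈ (CongruenceSubgroup.Gamma0 N).map (Matrix.SpecialLinearGroup.mapGL ℝ)) :
    diagGL a ha * γ * (diagGL a ha)⁻¹ ∈ 𝒮ℒ := by
  obtain ⟨γ, hγ, rfl⟩ := hγ
  obtain ⟨c, hc⟩ : (a : ℤ) ∣ γ 1 0 := by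
    have := (ZMod.intCast_zmod_eq_zero_iff_dvd _ _).mp (CongruenceSubgroup.Gamma0_mem.mp hγ)
    exact (Int.natCast_dvd_natCast.mpr haN).trans this
  have hdet : γ 0 0 * γ 1 1 - γ 0 1 * γ 1 0 = 1 := by
    rw [← Matrix.det_fin_two]
    exact γ.det_coe
  obtain ⟨δ, hδ⟩ : ∃ δ : SL(2, ℤ), (δ : Matrix (Fin 2) (Fin 2) ℤ) =
      !![γ 0 0, a * γ 0 1; c, γ 1 1] := by
    refine ⟨⟨!![γ 0 0, a * γ 0 1; c, γ 1 1], ?_⟩, rfl⟩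
    rw [Matrix.det_fin_two_of]
    rw [hc] at hdet
    linear_combination hdet
  refine ⟨δ, ?_⟩
  rw [eq_mul_inv_iff_mul_eq]
  have hc' : ((γ 1 0 : ℤ) : ℝ) = a * c := by rw [hc]; push_cast; rfl
  ext i j
  fin_cases i <;> fin_cases j <;>
    simp [diagGL, Matrix.GeneralLinearGroup.mkOfDetNeZero, Matrix.mul_apply, Fin.sum_univ_two,
      hδ, hc', mul_comm]

/-! ### The modular forms on Γ₀(N) -/

/-- Coefficient extraction at infinity as a linear functional on modular forms for `Γ₀(N)`. -/
noncomputable def fourierCoeffLinear (k : ℤ) (N n : ℕ) : ModFormSpace k N →ₗ[ℂ] ℂ where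
  toFun f := fourierCoeffInf f n
  map_add' f g := by
    have h1 : (1 : ℝ) ∈ ((CongruenceSubgroup.Gamma0 N).map
      (Matrix.SpecialLinearGroup.mapGL ℝ)).strictPeriods := by simp
    simp only [fourierCoeffInf, FunLike.coe_add, ModularForm.qExpansion_add one_pos h1 f g, map_add]
  map_smul' r f := by
    have h1 : (1 : ℝ) ∈ ((CongruenceSubgroup.Gamma0 N).map
      (Matrix.SpecialLinearGroup.mapGL ℝ)).strictPeriods := by simp
    simp only [fourierCoeffInf, FunLike.coe_smul, ModularForm.qExpansion_smul one_pos h1 r f,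
      map_smul, RingHom.id_apply]

theorem fourierCoeffInf_eq {k : ℤ} {N : ℕ} (f : ModFormSpace k N) {c : ℕ → ℂ}
    (hf : HasQSeries f c) (n : ℕ) : fourierCoeffInf f n = c n :=
  hf.coeff_eq n

/-- The correction a · 3/(π a Im z) does not depend on a. The left side shows holomorphy, the right
side invariance and boundedness. -/
theorem E2_slash_sub_eq {a b : ℕ} (ha : 0 < a) (hb : 0 < b) :
    E2 ∣[(2 : ℤ)] diagGL a ha - E2 ∣[(2 : ℤ)] diagGL b hb =
      E2Star ∣[(2 : ℤ)] diagGL a ha + (-E2Star) ∣[(2 : ℤ)] diagGL b hb := by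
  ext z
  have him (n : ℕ) (hn : 0 < n) : (diagGL n hn • z).im = n * z.im := by
    rw [← coe_im, coe_diagGL_smul]
    simp
  have ha0 : (a : ℂ) ≠ 0 := Nat.cast_ne_zero.mpr ha.ne'
  have hb0 : (b : ℂ) ≠ 0 := Nat.cast_ne_zero.mpr hb.ne'
  have hy : (z.im : ℂ) ≠ 0 := Complex.ofReal_ne_zero.mpr z.im_ne_zero
  have hpi := Complex.ofReal_ne_zero.mpr Real.pi_ne_zero
  simp only [Pi.sub_apply, Pi.add_apply, Pi.neg_apply, slash_diagGL_apply, E2Star, him]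
  push_cast
  norm_num
  field_simp
  ring

/-- The modular form `a E₂(a z) - b E₂(b z)` of weight `2` on `Γ₀(N)`, for `a, b ∣ N`. -/
noncomputable def e2Difference {a b N : ℕ} (ha : 0 < a) (hb : 0 < b) (haN : a ∣ N) (hbN : b ∣ N) :
    ModFormSpace 2 N where
  toFun := E2 ∣[(2 : ℤ)] diagGL a ha - E2 ∣[(2 : ℤ)] diagGL b hb
  slash_action_eq' γ hγ := by
    rw [E2_slash_sub_eq, SlashAction.add_slash,
      slash_slash_of_conj_mem_SL (fun _ ↦ diagGL_conj_mem_SL ha haN) E2Star_slash hγ,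
      slash_slash_of_conj_mem_SL (fun _ ↦ diagGL_conj_mem_SL hb hbN)
        (fun _ ↦ by rw [SlashAction.neg_slash, E2Star_slash]) hγ]
  holo' := (E2_mdifferentiable.slash 2 _).sub (E2_mdifferentiable.slash 2 _)
  bdd_at_cusps' hc := by
    rw [E2_slash_sub_eq]
    exact (isBoundedAt_slash_of_conj_mem_SL (fun _ ↦ diagGL_conj_mem_SL ha haN) E2Star_slash
      isBoundedAtImInfty_E2Star hc).add
      (isBoundedAt_slash_of_conj_mem_SL (fun _ ↦ diagGL_conj_mem_SL hb hbN)
        (fun _ ↦ by rw [SlashAction.neg_slash, E2Star_slash]) isBoundedAtImInfty_E2Star.neg hc)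

theorem mdifferentiable_ramanujanE4 : MDiff ramanujanE4 :=
  (hasQSeries_E2.mul hasQSeries_E2).mdiff.sub (hasQSeries_E2.normalizedDeriv.smul 12).mdiff

theorem isBoundedAtImInfty_ramanujanE4 : IsBoundedAtImInfty ramanujanE4 :=
  (hasQSeries_E2.mul hasQSeries_E2).bounded.sub (hasQSeries_E2.normalizedDeriv.smul 12).bounded

/-- The modular form `a³ (E₂² - 12 D E₂)(a z)` of weight `4` on `Γ₀(N)`, for `a ∣ N`. -/
noncomputable def ramanujanE4Scaled {a N : ℕ} (ha : 0 < a) (haN : a ∣ N) : ModFormSpace 4 N where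
  toFun := ramanujanE4 ∣[(4 : ℤ)] diagGL a ha
  slash_action_eq' _ hγ :=
    slash_slash_of_conj_mem_SL (fun _ ↦ diagGL_conj_mem_SL ha haN) ramanujanE4_slash hγ
  holo' := mdifferentiable_ramanujanE4.slash 4 _
  bdd_at_cusps' hc :=
    isBoundedAt_slash_of_conj_mem_SL (fun _ ↦ diagGL_conj_mem_SL ha haN) ramanujanE4_slash
      isBoundedAtImInfty_ramanujanE4 hc

/-- The modular form `(a E₂(a z) - b E₂(b z))² - a² (E₂² - 12 D E₂)(a z) - b² (E₂² - 12 D E₂)(b z)`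
of weight `4` on `Γ₀(N)`, for `a, b ∣ N`. -/
noncomputable def convolutionForm {a b N : ℕ} (ha : 0 < a) (hb : 0 < b) (haN : a ∣ N)
    (hbN : b ∣ N) : ModFormSpace 4 N :=
  ModularForm.mcast (by norm_num)
      ((e2Difference ha hb haN hbN).mul (e2Difference ha hb haN hbN))
    - (a : ℂ)⁻¹ • ramanujanE4Scaled ha haN - (b : ℂ)⁻¹ • ramanujanE4Scaled hb hbN

/-- The squares of E₂ cancel: the weight 4 slash contributes a³, and the factor a⁻¹ matches it to
the a² in the square. -/
theorem coe_convolutionForm {a b N : ℕ} (ha : 0 < a) (hb : 0 < b) (haN : a ∣ N) (hbN : b ∣ N) :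
    (convolutionForm ha hb haN hbN : ℍ → ℂ) =
      (12 / a : ℂ) • (D E2 ∣[(4 : ℤ)] diagGL a ha) + (12 / b : ℂ) • (D E2 ∣[(4 : ℤ)] diagGL b hb)
        + (-2 : ℂ) • ((E2 ∣[(2 : ℤ)] diagGL a ha) * (E2 ∣[(2 : ℤ)] diagGL b hb)) := by
  ext z
  have ha0 : (a : ℂ) ≠ 0 := Nat.cast_ne_zero.mpr ha.ne'
  have hb0 : (b : ℂ) ≠ 0 := Nat.cast_ne_zero.mpr hb.ne'
  have h : convolutionForm ha hb haN hbN z =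
      ((E2 ∣[(2 : ℤ)] diagGL a ha) z - (E2 ∣[(2 : ℤ)] diagGL b hb) z) *
        ((E2 ∣[(2 : ℤ)] diagGL a ha) z - (E2 ∣[(2 : ℤ)] diagGL b hb) z)
      - (a : ℂ)⁻¹ * (ramanujanE4 ∣[(4 : ℤ)] diagGL a ha) z
      - (b : ℂ)⁻¹ * (ramanujanE4 ∣[(4 : ℤ)] diagGL b hb) z := rfl
  rw [h]
  simp only [Pi.add_apply, Pi.mul_apply, Pi.smul_apply, smul_eq_mul, slash_diagGL_apply,
    ramanujanE4, Pi.sub_apply, show (2 : ℤ) - 1 = 1 from rfl, show (4 : ℤ) - 1 = (3 : ℕ) from rfl,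
    zpow_one, zpow_natCast]
  field_simp
  ring

/-! ### Fourier coefficients and the convolution sum -/

/-- The function `n ↦ σ(n / a)`, which vanishes unless `a ∣ n`. -/
def sigmaDiv (a n : ℕ) : ℕ := if a ∣ n then ArithmeticFunction.sigma 1 (n / a) else 0

theorem sigmaExt_div {a n : ℕ} (ha : 0 < a) : sigmaExt 1 ((n : ℚ) / a) = sigmaDiv a n := by
  have ha0 : (a : ℚ) ≠ 0 := Nat.cast_ne_zero.mpr ha.ne'
  rw [sigmaDiv]
  split_ifs with h
  · obtain ⟨m, rfl⟩ := h
    rw [Nat.cast_mul, mul_div_cancel_left₀ _ ha0, Nat.mul_div_cancel_left _ ha, sigmaExt]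
    rcases m.eq_zero_or_pos with rfl | hm
    · simp
    · simp [hm]
  · rw [sigmaExt, if_neg]
    rintro ⟨_, hden⟩
    obtain ⟨m, hm⟩ : ∃ m : ℤ, (n : ℚ) / a = m := ⟨_, ((Rat.den_eq_one_iff _).mp hden).symm⟩
    rw [div_eq_iff ha0, mul_comm] at hm
    exact h (Int.natCast_dvd_natCast.mp ⟨m, by exact_mod_cast hm⟩)

theorem sum_antidiagonal_sigmaDiv {a b : ℕ} (ha : 0 < a) (hb : 0 < b) (n : ℕ) :
    ∑ p ∈ Finset.HasAntidiagonal.antidiagonal n, sigmaDiv a p.1 * sigmaDiv b p.2 =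
      convSum 1 1 a b n := by
  symm
  refine Finset.sum_of_injOn (fun p ↦ (a * p.1, b * p.2)) ?_ ?_ ?_ ?_
  · rintro ⟨x, y⟩ _ ⟨x', y'⟩ _ h
    simp only [Prod.mk.injEq] at h
    exact Prod.ext (Nat.eq_of_mul_eq_mul_left ha h.1) (Nat.eq_of_mul_eq_mul_left hb h.2)
  · intro p hp
    simpa using ((mem_convPairs ha hb n p).mp hp).2.2
  · rintro ⟨i, j⟩ hij hne
    rw [Finset.HasAntidiagonal.mem_antidiagonal] at hij
    simp only [sigmaDiv]
    split_ifs with hi hj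
    · obtain ⟨x, rfl⟩ := hi
      obtain ⟨y, rfl⟩ := hj
      rw [Nat.mul_div_cancel_left _ ha, Nat.mul_div_cancel_left _ hb]
      -- Pairs with a zero entry contribute nothing, as `sigma 1 0 = 0`.
      rcases x.eq_zero_or_pos with rfl | hx
      · simp
      rcases y.eq_zero_or_pos with rfl | hy
      · simp
      exact absurd ⟨(x, y), (mem_convPairs ha hb n _).mpr ⟨hx, hy, hij⟩, rfl⟩ hne
    all_goals simp
  · rintro ⟨x, y⟩ _
    simp [sigmaDiv, ha, hb]

theorem E2_coeff_div (a n : ℕ) :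
    (if a ∣ n then (if n / a = 0 then 1 else -24 * (ArithmeticFunction.sigma 1 (n / a) : ℂ)) else 0)
      = (if n = 0 then 1 else 0) - 24 * (sigmaDiv a n : ℂ) := by
  rw [sigmaDiv]
  split_ifs with h h1 h2 h2 h3
  · simp [h2]
  · exact absurd (Nat.eq_zero_of_dvd_of_div_eq_zero h h1) h2
  · simp [h2] at h1
  · simp
  · simp [h3] at h
  · simp

theorem fourierCoeffInf_convolutionForm {a b N : ℕ} (ha : 0 < a) (hb : 0 < b) (haN : a ∣ N)
    (hbN : b ∣ N) {n : ℕ} (hn : 0 < n) :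
    fourierCoeffInf (convolutionForm ha hb haN hbN) n =
      -288 * a * n * sigmaDiv a n - 288 * b * n * sigmaDiv b n
        - 2 * a * b * (-24 * sigmaDiv a n - 24 * sigmaDiv b n + 576 * convSum 1 1 a b n) := by
  have ha0 : (a : ℂ) ≠ 0 := Nat.cast_ne_zero.mpr ha.ne'
  have hb0 : (b : ℂ) ≠ 0 := Nat.cast_ne_zero.mpr hb.ne'
  have hD := hasQSeries_E2.normalizedDeriv
  have hser := (((hD.slash_diagGL 4 a ha).smul (12 / a : ℂ)).add
    ((hD.slash_diagGL 4 b hb).smul (12 / b : ℂ))).add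
    (((hasQSeries_E2.slash_diagGL 2 a ha).mul (hasQSeries_E2.slash_diagGL 2 b hb)).smul (-2))
  rw [← coe_convolutionForm ha hb haN hbN] at hser
  rw [fourierCoeffInf_eq _ hser n]
  have hdiv (r : ℕ) (hr : 0 < r) : (if r ∣ n then ((n / r : ℕ) : ℂ) *
      (if n / r = 0 then 1 else -24 * (ArithmeticFunction.sigma 1 (n / r) : ℂ)) else 0) =
      -24 * (n / r : ℂ) * sigmaDiv r n := by
    have hr0 : (r : ℂ) ≠ 0 := Nat.cast_ne_zero.mpr hr.ne'
    rw [sigmaDiv]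
    split_ifs with h h1
    · exact absurd (Nat.eq_zero_of_dvd_of_div_eq_zero h h1) hn.ne'
    · rw [Nat.cast_div h hr0]
      ring
    · simp
  have hsum : ∑ p ∈ Finset.HasAntidiagonal.antidiagonal n,
      (((if p.1 = 0 then 1 else 0) - 24 * (sigmaDiv a p.1 : ℂ)) *
        ((if p.2 = 0 then 1 else 0) - 24 * (sigmaDiv b p.2 : ℂ))) =
      -24 * sigmaDiv a n - 24 * sigmaDiv b n + 576 * convSum 1 1 a b n := by
    have hl (F : ℕ → ℂ) : ∑ p ∈ Finset.HasAntidiagonal.antidiagonal n,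
        (if p.1 = 0 then F p.2 else 0) = F n := by
      rw [Finset.sum_eq_single (0, n)]
      · simp
      · rintro ⟨i, j⟩ hij hne
        refine if_neg fun h ↦ hne ?_
        simp_all
      · simp
    have hr (F : ℕ → ℂ) : ∑ p ∈ Finset.HasAntidiagonal.antidiagonal n,
        (if p.2 = 0 then F p.1 else 0) = F n := by
      rw [Finset.sum_eq_single (n, 0)]
      · simp
      · rintro ⟨i, j⟩ hij hne
        refine if_neg fun h ↦ hne ?_
        simp_all
      · simp
    have hterm (p : ℕ × ℕ) (hp : p ∈ Finset.HasAntidiagonal.antidiagonal n) :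
        ((if p.1 = 0 then 1 else 0) - 24 * (sigmaDiv a p.1 : ℂ)) *
          ((if p.2 = 0 then 1 else 0) - 24 * (sigmaDiv b p.2 : ℂ)) =
        (if p.1 = 0 then -24 * (sigmaDiv b p.2 : ℂ) else 0) +
          (if p.2 = 0 then -24 * (sigmaDiv a p.1 : ℂ) else 0) +
          576 * ((sigmaDiv a p.1 * sigmaDiv b p.2 : ℕ) : ℂ) := by
      rw [Finset.HasAntidiagonal.mem_antidiagonal] at hp
      push_cast
      split_ifs
      -- Both indices cannot vanish, since they sum to n > 0.
      · omega
      all_goals ring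
    rw [Finset.sum_congr rfl hterm, Finset.sum_add_distrib, Finset.sum_add_distrib,
      hl fun j ↦ -24 * (sigmaDiv b j : ℂ), hr fun i ↦ -24 * (sigmaDiv a i : ℂ), ← Finset.mul_sum,
      ← Nat.cast_sum, sum_antidiagonal_sigmaDiv ha hb]
    ring
  simp only [Pi.add_apply, Pi.smul_apply, smul_eq_mul, hdiv a ha, hdiv b hb, E2_coeff_div,
    show (2 : ℤ) - 1 = 1 from rfl, show (4 : ℤ) - 1 = (3 : ℕ) from rfl,
    zpow_one, zpow_natCast]
  rw [← hsum]
  have hpull : ∑ p ∈ Finset.HasAntidiagonal.antidiagonal n,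
      ((a : ℂ) * ((if p.1 = 0 then 1 else 0) - 24 * (sigmaDiv a p.1 : ℂ))) *
        ((b : ℂ) * ((if p.2 = 0 then 1 else 0) - 24 * (sigmaDiv b p.2 : ℂ))) =
      a * b * ∑ p ∈ Finset.HasAntidiagonal.antidiagonal n,
      (((if p.1 = 0 then 1 else 0) - 24 * (sigmaDiv a p.1 : ℂ)) *
        ((if p.2 = 0 then 1 else 0) - 24 * (sigmaDiv b p.2 : ℂ))) := by
    rw [Finset.mul_sum]
    exact Finset.sum_congr rfl fun p _ ↦ by ring
  rw [hpull]
  field_simp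
  ring

theorem corollary2p4 (a b : ℕ) (ha : 0 < a) (hb : 0 < b) (hab : Nat.Coprime a b)
    (g : Module.Basis (Fin (modFormDim 4 (a * b))) ℂ (ModFormSpace 4 (a * b))) :
    ∃ β : Fin (modFormDim 4 (a * b)) → ℂ, ∀ n : ℕ, 0 < n →
      (convSum 1 1 a b n : ℂ) =
        (1 / 24 : ℂ) * (1 - 6 * (n : ℂ) / (b : ℂ)) * (sigmaExt 1 ((n : ℚ) / (a : ℚ)) : ℂ)
        + (1 / 24 : ℂ) * (1 - 6 * (n : ℂ) / (a : ℂ)) * (sigmaExt 1 ((n : ℚ) / (b : ℚ)) : ℂ)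
        - (1 / 576 : ℂ) * ∑ i, β i * fourierCoeffInf (g i) n := by
  have ha0 : (a : ℂ) ≠ 0 := Nat.cast_ne_zero.mpr ha.ne'
  have hb0 : (b : ℂ) ≠ 0 := Nat.cast_ne_zero.mpr hb.ne'
  let Φ := convolutionForm ha hb (Dvd.intro b rfl) (Dvd.intro_left a rfl)
  -- W_{a,b}(n) enters the coefficient of Φ with factor -2ab · 576; dividing by 2ab leaves the
  -- required -1/576.
  refine ⟨fun i ↦ g.repr Φ i / (2 * a * b), fun n hn ↦ ?_⟩
  have hcoeff : ∑ i, g.repr Φ i * fourierCoeffInf (g i) n = fourierCoeffInf Φ n := by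
    have := congrArg (fourierCoeffLinear 4 (a * b) n) (g.sum_repr Φ)
    rw [map_sum] at this
    simp only [map_smul, smul_eq_mul] at this
    exact this
  have hsum : ∑ i, g.repr Φ i / (2 * a * b) * fourierCoeffInf (g i) n =
      fourierCoeffInf Φ n / (2 * a * b) := by
    rw [← hcoeff, Finset.sum_div]
    exact Finset.sum_congr rfl fun i _ ↦ by ring
  rw [hsum, fourierCoeffInf_convolutionForm ha hb _ _ hn, sigmaExt_div ha, sigmaExt_div hb]
  field_simp
  ring
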